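/- For $n\ge 3$ and $p\in[0,1]$, the discrete Bak--Sneppen chain is the Markov chain on $\{0,1\}^n$, with coordinates placed on the cycle $\mathbb{Z}/n\mathbb{Z}$, in which at each step a vertex $i$ is picked uniformly at random among the vertices with value $0$ (among all vertices if there is no zero), and the values at $i-1,i,i+1$ (modulo $n$) are replaced by independent Bernoulli$(p)$ random variables, all other values being kept. It has a unique stationary distribution $\pi^{(n)}$; let $\nu^{(n)}(p)$ be the probability under $\pi^{(n)}$ that a given vertex has value $1$ (by symmetry, this does not depend on the vertex). **Theorem.** The equation $p^5+4p^4+2p^3+3p^2=1$ has exactly one non-negative real solution $p_\diamond$, and $p_\diamond=0.45\ldots$. For every $p\in(p_\diamond,1]$ the limit $\nu(p)=\lim_{n\to\infty}\nu^{(n)}(p)$ exists and equals $1$. Hence, if a critical value $p_c$ exists, that is, a number $p_c\in[0,1]$ such that $\nu(p)=\lim_{n\to\infty}\nu^{(n)}(p)$ exists and equals $1$ for all $p\in(p_c,1]$, and exists and is less than $1$ for all $p\in[0,p_c)$, then $p_c\le p_\diamond$. -/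

import Mathlib

open Filter Topology

namespace BakSneppen

/-- Configurations of zeros and ones on the cycle with `n` vertices;
`true` stands for the value one and `false` for the value zero. -/
abbrev Config (n : ℕ) : Type := Fin n → Bool

/-- The vertices that may be picked: those with value zero, or all vertices if there is no zero. -/
def eligible {n : ℕ} (x : Config n) : Finset (Fin n) :=
  if ∃ i, x i = false then Finset.univ.filter (fun i => x i = false) else Finset.univ

/-- A vertex with its two neighbours; subtraction and addition in `Fin n` are modulo `n`. -/
def block {n : ℕ} [NeZero n] (i : Fin n) : Finset (Fin n) := {i - 1, i, i + 1}

/-- The Bernoulli weights: one has probability `p`, zero has probability `1 - p`. -/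
def bernoulliWeight (p : ℝ) (b : Bool) : ℝ := if b = true then p else 1 - p

/-- The probability that `x` becomes `y` when the values on the block around `i` are replaced by
independent Bernoulli variables and all other values are kept. -/
def updateProb {n : ℕ} [NeZero n] (p : ℝ) (x : Config n) (i : Fin n) (y : Config n) : ℝ :=
  ∏ j, if j ∈ block i then bernoulliWeight p (y j) else if y j = x j then 1 else 0

/-- The transition matrix of the discrete Bak-Sneppen chain: an eligible vertex is picked uniformly
at random, and the block around it is updated. -/
noncomputable def transition (n : ℕ) [NeZero n] (p : ℝ) : Matrix (Config n) (Config n) ℝ :=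
  fun x y => ∑ i ∈ eligible x, (1 / ((eligible x).card : ℝ)) * updateProb p x i y

/-- `π` is a stationary probability distribution of the Markov chain with transition matrix `P`. -/
def IsStationary {S : Type*} [Fintype S] (P : Matrix S S ℝ) (π : S → ℝ) : Prop :=
  π ∈ stdSimplex ℝ S ∧ Matrix.vecMul π P = π

/-! The chain has exactly one stationary distribution. -/

section General

variable {S : Type*} [Fintype S] [DecidableEq S]

theorem abs_vecMul_of_vecMul {P : Matrix S S ℝ} (hP : P ∈ Matrix.rowStochastic ℝ S)
    {v : S → ℝ} (hv : Matrix.vecMul v P = v) :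
    Matrix.vecMul (fun x => |v x|) P = fun x => |v x| := by
  have h0 : ∀ x y, 0 ≤ P x y := fun x y => Matrix.nonneg_of_mem_rowStochastic hP
  have hle : ∀ y ∈ Finset.univ, |v y| ≤ Matrix.vecMul (fun x => |v x|) P y := by
    intro y _
    conv_lhs => rw [← hv]
    simp only [Matrix.vecMul, dotProduct]
    refine (Finset.abs_sum_le_sum_abs _ _).trans (le_of_eq ?_)
    refine Finset.sum_congr rfl fun x _ => ?_
    rw [abs_mul, abs_of_nonneg (h0 x y)]
  have hsum : ∑ y, |v y| = ∑ y, Matrix.vecMul (fun x => |v x|) P y := by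
    simp only [Matrix.vecMul, dotProduct]
    rw [Finset.sum_comm]
    refine Finset.sum_congr rfl fun x _ => ?_
    rw [← Finset.mul_sum, Matrix.sum_row_of_mem_rowStochastic hP, mul_one]
  funext y
  exact ((Finset.sum_eq_sum_iff_of_le hle).1 hsum y (Finset.mem_univ y)).symm

theorem pos_of_reachable {P : Matrix S S ℝ} (hP : P ∈ Matrix.rowStochastic ℝ S)
    {v : S → ℝ} (hv0 : ∀ x, 0 ≤ v x) (hv : Matrix.vecMul v P = v) {x s : S}
    (h : Relation.ReflTransGen (fun a b => 0 < P a b) x s) (hx : 0 < v x) : 0 < v s := by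
  induction h with
  | refl => exact hx
  | @tail b c _ hbc ih =>
    have : v b * P b c ≤ v c := by
      conv_rhs => rw [← hv]
      simp only [Matrix.vecMul, dotProduct]
      exact Finset.single_le_sum (f := fun a => v a * P a c)
        (fun a _ => mul_nonneg (hv0 a) (Matrix.nonneg_of_mem_rowStochastic hP))
        (Finset.mem_univ b)
    exact lt_of_lt_of_le (mul_pos ih hbc) this

theorem existsUnique_isStationary {P : Matrix S S ℝ} (hP : P ∈ Matrix.rowStochastic ℝ S) (s : S)
    (hs : ∀ x, Relation.ReflTransGen (fun a b => 0 < P a b) x s) :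
    ∃! π : S → ℝ, IsStationary P π := by
  refine existsUnique_of_exists_of_unique ?_ ?_
  · have hdet : (P - 1).det = 0 := by
      refine Matrix.exists_mulVec_eq_zero_iff.1 ⟨1, ?_, ?_⟩
      · intro h
        exact one_ne_zero (congrFun h s)
      · rw [Matrix.sub_mulVec, Matrix.one_vecMul_of_mem_rowStochastic hP, Matrix.one_mulVec,
          sub_self]
    obtain ⟨v, hv0, hv⟩ := Matrix.exists_vecMul_eq_zero_iff.2 hdet
    rw [Matrix.vecMul_sub, Matrix.vecMul_one, sub_eq_zero] at hv
    have habs := abs_vecMul_of_vecMul hP hv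
    obtain ⟨a, ha⟩ := Function.ne_iff.1 hv0
    have hpos : 0 < ∑ x, |v x| :=
      Finset.sum_pos' (fun x _ => abs_nonneg _) ⟨a, Finset.mem_univ a, abs_pos.2 ha⟩
    refine ⟨(∑ x, |v x|)⁻¹ • fun x => |v x|, ⟨fun x => ?_, ?_⟩, ?_⟩
    · exact mul_nonneg (inv_nonneg.2 hpos.le) (abs_nonneg _)
    · simp only [Pi.smul_apply, smul_eq_mul]
      rw [← Finset.mul_sum, inv_mul_cancel₀ hpos.ne']
    · rw [Matrix.smul_vecMul, habs]
  · rintro π π' ⟨⟨_, h1⟩, hst⟩ ⟨⟨_, h1'⟩, hst'⟩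
    by_contra hne
    have hd : Matrix.vecMul (π - π') P = π - π' := by rw [Matrix.sub_vecMul, hst, hst']
    have habs := abs_vecMul_of_vecMul hP hd
    have hsum : ∑ x, (π - π') x = 0 := by
      simp only [Pi.sub_apply, Finset.sum_sub_distrib, h1, h1', sub_self]
    have key : ∀ w : S → ℝ, Matrix.vecMul w P = w → Matrix.vecMul (fun x => |w x|) P =
        (fun x => |w x|) → w ≠ 0 → ∑ x, w x = 0 → 0 < w s := by
      intro w hw hwabs hw0 hws
      have hex : ∃ x, 0 < w x := by
        by_contra hcon
        push Not at hcon
        refine hw0 (funext fun x => ?_)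
        exact (Finset.sum_eq_zero_iff_of_nonpos (fun x _ => hcon x)).1 hws x (Finset.mem_univ x)
      obtain ⟨x, hx⟩ := hex
      have hplus : Matrix.vecMul ((fun x => |w x|) + w) P = (fun x => |w x|) + w := by
        rw [Matrix.add_vecMul, hwabs, hw]
      have := pos_of_reachable hP (v := (fun x => |w x|) + w)
        (fun y => by simp only [Pi.add_apply]; linarith [neg_abs_le (w y)])
        hplus (hs x) (by simp only [Pi.add_apply]; positivity)
      by_contra hneg
      simp only [Pi.add_apply] at this
      rw [abs_of_nonpos (not_lt.1 hneg)] at this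
      linarith
    have hp := key (π - π') hd habs (sub_ne_zero.2 hne) hsum
    have hm := key (-(π - π')) (by rw [Matrix.neg_vecMul, hd])
      (by simpa only [Pi.neg_apply, abs_neg] using habs) (neg_ne_zero.2 (sub_ne_zero.2 hne))
      (by simp only [Pi.neg_apply, Finset.sum_neg_distrib, hsum, neg_zero])
    simp only [Pi.neg_apply] at hm
    linarith

end General

section Chain

theorem mem_eligible_of_false {n : ℕ} {x : Config n} {i : Fin n}
    (h : x i = false) : i ∈ eligible x := by
  have : ∃ i, x i = false := ⟨i, h⟩
  simp [eligible, this, h]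

variable {n : ℕ} [NeZero n]

theorem bernoulliWeight_nonneg {p : ℝ} (hp : p ∈ Set.Icc (0 : ℝ) 1) (b : Bool) :
    0 ≤ bernoulliWeight p b := by
  unfold bernoulliWeight
  split_ifs
  · exact hp.1
  · linarith [hp.2]

theorem eligible_nonempty (x : Config n) : (eligible x).Nonempty := by
  unfold eligible
  split_ifs with h
  · obtain ⟨i, hi⟩ := h
    exact ⟨i, by simpa using hi⟩
  · exact Finset.univ_nonempty

theorem updateProb_nonneg {p : ℝ} (hp : p ∈ Set.Icc (0 : ℝ) 1) (x : Config n) (i : Fin n)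
    (y : Config n) : 0 ≤ updateProb p x i y := by
  refine Finset.prod_nonneg fun j _ => ?_
  split_ifs
  · exact bernoulliWeight_nonneg hp _
  · exact zero_le_one
  · exact le_rfl

theorem sum_updateProb (p : ℝ) (x : Config n) (i : Fin n) : ∑ y, updateProb p x i y = 1 := by
  unfold updateProb
  have := Finset.prod_univ_sum (fun _ : Fin n => (Finset.univ : Finset Bool))
    (fun j b => if j ∈ block i then bernoulliWeight p b else if b = x j then (1 : ℝ) else 0)
  rw [Fintype.piFinset_univ] at this
  rw [← this]
  refine Finset.prod_eq_one fun j _ => ?_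
  split_ifs
  · simp [bernoulliWeight]
  · simp

theorem transition_mem_rowStochastic {p : ℝ} (hp : p ∈ Set.Icc (0 : ℝ) 1) :
    transition n p ∈ Matrix.rowStochastic ℝ (Config n) := by
  rw [Matrix.mem_rowStochastic_iff_sum]
  refine ⟨fun x y => ?_, fun x => ?_⟩
  · exact Finset.sum_nonneg fun i _ => mul_nonneg (by positivity) (updateProb_nonneg hp x i y)
  · have hc : ((eligible x).card : ℝ) ≠ 0 := by
      exact_mod_cast (Finset.card_pos.2 (eligible_nonempty x)).ne'
    simp only [transition]
    rw [Finset.sum_comm]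
    simp only [← Finset.mul_sum, sum_updateProb]
    simp [hc]

theorem transition_pos {p : ℝ} (hp : p ∈ Set.Icc (0 : ℝ) 1) {x : Config n} {i : Fin n}
    (hi : i ∈ eligible x) (b : Bool) (hb : 0 < bernoulliWeight p b) :
    0 < transition n p x (fun j => if j ∈ block i then b else x j) := by
  refine Finset.sum_pos' (fun k _ => mul_nonneg (by positivity) (updateProb_nonneg hp x k _))
    ⟨i, hi, mul_pos ?_ ?_⟩
  · have := Finset.card_pos.2 ⟨i, hi⟩
    positivity
  · refine Finset.prod_pos fun j _ => ?_
    by_cases hj : j ∈ block i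
    · simpa [hj] using hb
    · simp [hj]

/-- A constant configuration is reachable as soon as from every other configuration
some eligible block contains a vertex with the wrong value. -/
theorem reachable_const {p : ℝ} (hp : p ∈ Set.Icc (0 : ℝ) 1) (b : Bool)
    (hb : 0 < bernoulliWeight p b)
    (hstep : ∀ x : Config n, (∃ j, x j ≠ b) → ∃ i ∈ eligible x, ∃ j ∈ block i, x j ≠ b)
    (x : Config n) :
    Relation.ReflTransGen (fun a c => 0 < transition n p a c) x (fun _ => b) := by
  induction hk : (Finset.univ.filter fun j => x j ≠ b).card using Nat.strong_induction_on
    generalizing x with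
  | _ k ih =>
    by_cases hx : ∃ j, x j ≠ b
    · obtain ⟨i, hi, j, hj, hjb⟩ := hstep x hx
      refine Relation.ReflTransGen.head (transition_pos hp hi b hb) (ih _ ?_ _ rfl)
      rw [← hk]
      refine Finset.card_lt_card (Finset.ssubset_iff_of_subset ?_ |>.2 ⟨j, ?_, ?_⟩)
      · intro l
        simp only [Finset.mem_filter, Finset.mem_univ, true_and]
        split_ifs <;> simp
      · simpa using hjb
      · simp [hj]
    · push Not at hx
      rw [show x = fun _ => b from funext hx]

theorem exists_reachable {p : ℝ} (hp : p ∈ Set.Icc (0 : ℝ) 1) :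
    ∃ s : Config n, ∀ x, Relation.ReflTransGen (fun a c => 0 < transition n p a c) x s := by
  rcases hp.1.eq_or_lt with h0 | h0
  · refine ⟨fun _ => false, reachable_const hp false (by simp [bernoulliWeight, ← h0]) ?_⟩
    rintro x ⟨j, hj⟩
    by_cases hall : ∃ i, x i = false
    · by_contra hcon
      push Not at hcon
      obtain ⟨i, hi⟩ := hall
      have hk : ∀ k : ℕ, x (i + Fin.ofNat n k) = false := by
        intro k
        induction k with
        | zero => simpa using hi
        | succ k ih =>
          have := hcon _ (mem_eligible_of_false ih) (i + Fin.ofNat n k + 1) (by simp [block])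
          have he : Fin.ofNat n (k + 1) = Fin.ofNat n k + 1 := by
            ext
            simp [Fin.val_add]
          rwa [he, ← add_assoc]
      have := hk (j - i).val
      have he : Fin.ofNat n (j - i).val = j - i := by
        ext
        simp
      rw [he, add_sub_cancel] at this
      exact hj this
    · exact ⟨j, by simp [eligible, hall], j, by simp [block], hj⟩
  · refine ⟨fun _ => true, reachable_const hp true (by simpa [bernoulliWeight] using h0) ?_⟩
    rintro x ⟨j, hj⟩
    exact ⟨j, mem_eligible_of_false (by simpa using hj), j, by simp [block], hj⟩

theorem existsUnique_stationary (n : ℕ) [NeZero n] (p : unitInterval) :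
    ∃! π : Config n → ℝ, IsStationary (transition n (p : ℝ)) π := by
  obtain ⟨s, hs⟩ := exists_reachable (n := n) p.2
  exact existsUnique_isStationary (transition_mem_rowStochastic p.2) s hs

end Chain

/-- The unique stationary distribution of the discrete Bak-Sneppen chain. -/
noncomputable def stationary (n : ℕ) [NeZero n] (p : unitInterval) : Config n → ℝ :=
  (existsUnique_stationary n p).choose

theorem stationary_spec (n : ℕ) [NeZero n] (p : unitInterval) :
    IsStationary (transition n (p : ℝ)) (stationary n p) :=
  (existsUnique_stationary n p).choose_spec.1

/-- The stationary probability that the vertex `i` has value one. -/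
noncomputable def nuAt (n : ℕ) [NeZero n] (p : unitInterval) (i : Fin n) : ℝ :=
  ∑ x : Config n, stationary n p x * (if x i = true then 1 else 0)

/-- The stationary probability that a vertex has value one. By rotational symmetry it does not
depend on the vertex, so it is defined through the vertex `0`; see `nuAt_eq_nu`. -/
noncomputable def nu (n : ℕ) [NeZero n] (p : unitInterval) : ℝ := nuAt n p 0

section Symmetry

variable {n : ℕ} [NeZero n]

/-- Rotation of configurations. -/
def rotate (k : Fin n) : Config n ≃ Config n := (Equiv.addRight k).arrowCongr (Equiv.refl Bool)

theorem rotate_apply (k : Fin n) (x : Config n) (j : Fin n) : rotate k x j = x (j - k) := by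
  simp [rotate, Equiv.arrowCongr, sub_eq_add_neg]

theorem mem_eligible_rotate (k : Fin n) (x : Config n) (i : Fin n) :
    i + k ∈ eligible (rotate k x) ↔ i ∈ eligible x := by
  have h : (∃ i, rotate k x i = false) ↔ ∃ i, x i = false := by
    constructor
    · rintro ⟨i, hi⟩
      exact ⟨i - k, by rwa [rotate_apply] at hi⟩
    · rintro ⟨i, hi⟩
      exact ⟨i + k, by rwa [rotate_apply, add_sub_cancel_right]⟩
  unfold eligible
  by_cases hx : ∃ i, x i = false
  · rw [if_pos hx, if_pos (h.2 hx)]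
    simp [rotate_apply]
  · rw [if_neg hx, if_neg (fun h' => hx (h.1 h'))]
    simp

theorem eligible_rotate (k : Fin n) (x : Config n) :
    eligible (rotate k x) = (eligible x).map (Equiv.addRight k).toEmbedding := by
  ext i
  have := mem_eligible_rotate k x (i - k)
  rw [sub_add_cancel] at this
  rw [Finset.mem_map_equiv, this]
  simp [sub_eq_add_neg]

theorem mem_block_add (i j k : Fin n) : j + k ∈ block (i + k) ↔ j ∈ block i := by
  simp only [block, Finset.mem_insert, Finset.mem_singleton]
  rw [show i + k - 1 = (i - 1) + k by abel, show i + k + 1 = (i + 1) + k by abel]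
  simp only [add_left_inj]

theorem updateProb_rotate (p : ℝ) (k : Fin n) (x y : Config n) (i : Fin n) :
    updateProb p (rotate k x) (i + k) (rotate k y) = updateProb p x i y := by
  unfold updateProb
  rw [← Equiv.prod_comp (Equiv.addRight k)]
  refine Finset.prod_congr rfl fun j _ => ?_
  simp only [Equiv.coe_addRight, mem_block_add, rotate_apply, add_sub_cancel_right]

theorem transition_rotate (p : ℝ) (k : Fin n) (x y : Config n) :
    transition n p (rotate k x) (rotate k y) = transition n p x y := by
  unfold transition
  rw [eligible_rotate, Finset.sum_map, Finset.card_map]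
  simp [updateProb_rotate]

theorem stationary_rotate (p : unitInterval) (k : Fin n) (x : Config n) :
    stationary n p (rotate k x) = stationary n p x := by
  have h := stationary_spec n p
  have h' : IsStationary (transition n (p : ℝ)) (fun x => stationary n p (rotate k x)) := by
    refine ⟨⟨fun x => h.1.1 _, ?_⟩, ?_⟩
    · rw [Equiv.sum_comp (rotate k) (stationary n p)]
      exact h.1.2
    · funext y
      conv_rhs => rw [← h.2]
      simp only [Matrix.vecMul, dotProduct]
      rw [← Equiv.sum_comp (rotate k)
        (fun x => stationary n p x * transition n (p : ℝ) x (rotate k y))]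
      simp only [transition_rotate]
  exact congrFun ((existsUnique_stationary n p).unique h' h) x

theorem nuAt_eq_nu (p : unitInterval) (i : Fin n) : nuAt n p i = nu n p := by
  unfold nu nuAt
  rw [← Equiv.sum_comp (rotate i)]
  simp [stationary_rotate, rotate_apply]

end Symmetry

/-- `HasLimit p a` means that `nu n p`, with `n ≥ 3` vertices, tends to `a` as `n` tends to
infinity. The index is shifted so that exactly the values `n ≥ 3` occur. -/
def HasLimit (p : unitInterval) (a : ℝ) : Prop :=
  Tendsto (fun m : ℕ => nu (m + 3) p) atTop (𝓝 a)

/-- `pc` is a critical probability: the limit of `nu n p` is one for `p` above `pc`, and it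
exists and is less than one for `p` below `pc`. -/
def IsCritical (pc : ℝ) : Prop :=
  pc ∈ Set.Icc (0 : ℝ) 1 ∧
    (∀ p : unitInterval, pc < (p : ℝ) → HasLimit p 1) ∧
    (∀ p : unitInterval, (p : ℝ) < pc → ∃ a : ℝ, a < 1 ∧ HasLimit p a)

end BakSneppen

/-!
The proof exhibits an energy `energy x`, a sum of
a function `wordEnergy` of the five consecutive sites starting at `j`, over all `j`, that is at
least the number of zeros, vanishes on the all-ones configuration, and decreases in expectation by
at least `1 / 7` in one step from any configuration with a zero, for every `p ≥ 5 / 11`.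

Given such an energy, stationarity applied to its square does the rest. Each step changes the energy
by a bounded amount, so from `x` the square changes in expectation by at most
`2800 ^ 2 - (2 / 7) * energy x`. Its stationary mean change is zero, so the stationary mean of the
energy, hence that of the number of zeros, is bounded uniformly in `n`. By rotational symmetry
this mean number of zeros is `n * (1 - nu n p)`, so `nu n p = 1 - O(1 / n)`. The root of the quintic
is larger than `5 / 11`.

The negative drift holds only on average over the picked zero, not for each zero separately. An
update at `i` affects the words that start between `i - 5` and `i + 1`, and what the update does
to one of them is a function of six consecutive sites. Hence the sum over all zeros `i` of the
expected change is a sum, over all `j`, of a function of the six sites starting at `j`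
(`sum_energyChange`). To such a sum one may add the difference of a `potential` of the first five
sites and of the last five sites, since these differences cancel around the cycle. With a suitable
potential, affine in `p`, the bound holds for each of the 64 words of six sites
(`sum_outcomeWeight_localChange_le`). As a polynomial in `p` this is a cubic inequality on
`[5 / 11, 1]`; in the nonnegative variables `1 - p` and `p - (5 / 6) * (1 - p)` all its coefficients
have the right sign, which is a finite computation with integers (`coeffBound_ofBits`). The
integer weights of the energy and of the potential come from solving the linear program formed
by these inequalities.
-/

namespace BakSneppen

/-! ### The energy of a word and its change under an update -/

/-- One if the word `w` has a zero at one of the sites in `l`, and zero otherwise. Words are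
functions on `ℕ`, of which only the values at the first few sites matter. -/
def defect (l : List ℕ) (w : ℕ → Bool) : ℤ := bif l.all w then 0 else 1

/-- The contribution of the sites `0, …, 4` to the energy. Summed around the cycle, the first term
counts, with weight 240, the words of length five that contain a zero; the other terms are
corrections for the pattern of the zeros in the word. -/
def wordEnergy (w : ℕ → Bool) : ℤ :=
  240 * defect [0, 1, 2, 3, 4] w + 106 * defect [0, 1, 2] w - 68 * defect [0, 1, 3, 4] w
    - 64 * (defect [0, 2, 3, 4] w + defect [0, 1, 2, 4] w)
    + 12 * (defect [0, 3, 4] w + defect [0, 1, 4] w)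

/-- The word `w` with the values at `o - 1`, `o`, `o + 1` replaced by `a`, `b`, `c`. -/
def setWord (w : ℕ → Bool) (o : ℕ) (a b c : Bool) : ℕ → Bool := fun k =>
  if k + 1 = o then a else if k = o then b else if k = o + 1 then c else w k

/-- The change of the energy of the five sites starting at `s`, when the vertex `o` is picked and
`a`, `b`, `c` are the new values around it; zero if the value at `o` is one. -/
def wordChange (o s : ℕ) (a b c : Bool) (w : ℕ → Bool) : ℤ :=
  bif w o then 0
  else wordEnergy (fun k => setWord w o a b c (k + s)) - wordEnergy (fun k => w (k + s))

/-- All changes of the energy that an update causes within a window of six sites. The seven terms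
are the seven relative positions of a five-site word and a picked vertex whose block meets it. When
the picked vertex is in the word, or just to its right, the word starts the window; when it is just
to the left, the picked vertex does. -/
def localChange (a b c : Bool) (w : ℕ → Bool) : ℤ :=
  wordChange 0 1 a b c w + (wordChange 0 0 a b c w + wordChange 1 0 a b c w
    + wordChange 2 0 a b c w + wordChange 3 0 a b c w + wordChange 4 0 a b c w
    + wordChange 5 0 a b c w)

/-- The number with binary digits `w 0, …, w 4`. -/
def wordIndex (w : ℕ → Bool) : ℕ :=
  (w 0).toNat * 16 + (w 1).toNat * 8 + (w 2).toNat * 4 + (w 3).toNat * 2 + (w 4).toNat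

/-- The value at `p = 1` of the potential of the sites `0, …, 4`. -/
def potentialOne (w : ℕ → Bool) : ℤ :=
  [-72, -14, -13, 0, 87, -34, 183, 91, 33, 22, -58, -26, 145, 10, -65, -5, 49, 58, 70, 130, -9,
    -57, 31, 26, 153, 122, -10, 30, 58, 43, 44, 0].getD (wordIndex w) 0

/-- The value at `p = 0` of the potential of the sites `0, …, 4`. -/
def potentialZero (w : ℕ → Bool) : ℤ :=
  [79, 30, 35, 24, -23, 38, -56, -9, 25, 34, 62, 37, -8, 39, -10, -128, 17, 6, 12, -47, 50, 63, 4,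
    -46, 38, 20, 41, 58, -38, 31, 32, 0].getD (wordIndex w) 0

/-- The potential at `p = 1` of the first five sites minus that of the last five. -/
def gradOne (w : ℕ → Bool) : ℤ := potentialOne w - potentialOne (fun k => w (k + 1))

/-- The potential at `p = 0` of the first five sites minus that of the last five. -/
def gradZero (w : ℕ → Bool) : ℤ := potentialZero w - potentialZero (fun k => w (k + 1))

/-- The coefficient of `(1 - p) ^ 3` in the expected change of the energy within a window plus the
drop of the potential. The potential drop `p * gradOne w + (1 - p) * gradZero w` is made
homogeneous of degree three by the factor `(p + (1 - p)) ^ 2`. -/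
def coeff0 (w : ℕ → Bool) : ℤ := localChange false false false w + gradZero w

/-- The coefficient of `p * (1 - p) ^ 2`; see `coeff0`. -/
def coeff1 (w : ℕ → Bool) : ℤ :=
  localChange true false false w + localChange false true false w + localChange false false true w
    + (gradOne w + 2 * gradZero w)

/-- The coefficient of `p ^ 2 * (1 - p)`; see `coeff0`. -/
def coeff2 (w : ℕ → Bool) : ℤ :=
  localChange true true false w + localChange true false true w + localChange false true true w
    + (2 * gradOne w + gradZero w)

/-- The coefficient of `p ^ 3`; see `coeff0`. -/
def coeff3 (w : ℕ → Bool) : ℤ := localChange true true true w + gradOne w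

/-- The word that starts with the given six values. -/
def ofBits (a b c d e g : Bool) : ℕ → Bool := fun k =>
  match k with
  | 0 => a | 1 => b | 2 => c | 3 => d | 4 => e | _ => g

/-- With `q = 1 - p` and `u = p - (5 / 6) * q`, these are the inequalities between the coefficients
of `q ^ 3`, `q ^ 2 * u`, `q * u ^ 2`, `u ^ 3`, with denominators cleared, in

`coeff0 * q ^ 3 + coeff1 * p * q ^ 2 + coeff2 * p ^ 2 * q + coeff3 * p ^ 3 ≤ -(1 / 7) * (p + q) ^ 3`

for a word with `w 0 = 0`; if `w 0 = 1`, the right-hand side is zero. -/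
def coeffBound (w : ℕ → Bool) : Prop :=
    7 * (216 * coeff0 w + 180 * coeff1 w + 150 * coeff2 w + 125 * coeff3 w)
        ≤ -1331 * (if w 0 then 0 else 1) ∧
      7 * (36 * coeff1 w + 60 * coeff2 w + 75 * coeff3 w) ≤ -363 * (if w 0 then 0 else 1) ∧
      7 * (2 * coeff2 w + 5 * coeff3 w) ≤ -11 * (if w 0 then 0 else 1) ∧
      7 * coeff3 w ≤ -(if w 0 then 0 else 1)

instance (w : ℕ → Bool) : Decidable (coeffBound w) := by unfold coeffBound; infer_instance

theorem coeffBound_ofBits : ∀ a b c d e g : Bool, coeffBound (ofBits a b c d e g) := by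
  decide +kernel

theorem localChange_ofBits (a b c : Bool) (w : ℕ → Bool) :
    localChange a b c (ofBits (w 0) (w 1) (w 2) (w 3) (w 4) (w 5)) = localChange a b c w := by
  simp [localChange, wordChange, wordEnergy, defect, setWord, ofBits]

theorem coeffBound_all (w : ℕ → Bool) : coeffBound w := by
  have h := coeffBound_ofBits (w 0) (w 1) (w 2) (w 3) (w 4) (w 5)
  simpa only [coeffBound, coeff0, coeff1, coeff2, coeff3, localChange_ofBits, gradOne, gradZero,
    potentialOne, potentialZero, wordIndex, ofBits, Nat.reduceAdd] using h

/-- The potential of the sites `0, …, 4`, affine in `p`. -/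
noncomputable def potential (p : ℝ) (w : ℕ → Bool) : ℝ :=
  p * potentialOne w + (1 - p) * potentialZero w

/-- The probability that an update produces the values `a`, `b`, `c`. -/
noncomputable def outcomeWeight (p : ℝ) (a b c : Bool) : ℝ :=
  bernoulliWeight p a * bernoulliWeight p b * bernoulliWeight p c

/-- The local drift bound: up to a difference of potentials, which cancels when summed around the
cycle, the expected change of the energy within a window is at most `-1 / 7` for each zero. -/
theorem sum_outcomeWeight_localChange_le {p : ℝ} (hp : 5 / 11 ≤ p) (hp1 : p ≤ 1) (w : ℕ → Bool) :
    ∑ a, ∑ b, ∑ c, outcomeWeight p a b c * localChange a b c w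
      ≤ potential p (fun k => w (k + 1)) - potential p w - 1 / 7 * (if w 0 then 0 else 1) := by
  obtain ⟨h0, h1, h2, h3⟩ := coeffBound_all w
  have key : ∑ a, ∑ b, ∑ c, outcomeWeight p a b c * (localChange a b c w : ℝ)
      + (potential p w - potential p (fun k => w (k + 1)))
      = coeff0 w * (1 - p) ^ 3 + coeff1 w * (p * (1 - p) ^ 2) + coeff2 w * (p ^ 2 * (1 - p))
        + coeff3 w * p ^ 3 := by
    simp only [Fintype.sum_bool, outcomeWeight, bernoulliWeight, potential, coeff0, coeff1, coeff2,
      coeff3, gradOne, gradZero]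
    push_cast
    ring
  set z : ℤ := if w 0 then 0 else 1 with hz
  have hz' : (if w 0 then 0 else 1 : ℝ) = (z : ℝ) := by
    rw [hz]; split_ifs <;> simp
  rw [hz']
  have h0' : (7 : ℝ) * (216 * coeff0 w + 180 * coeff1 w + 150 * coeff2 w + 125 * coeff3 w)
      ≤ -1331 * z := by exact_mod_cast h0
  have h1' : (7 : ℝ) * (36 * coeff1 w + 60 * coeff2 w + 75 * coeff3 w) ≤ -363 * z := by
    exact_mod_cast h1
  have h2' : (7 : ℝ) * (2 * coeff2 w + 5 * coeff3 w) ≤ -11 * z := by exact_mod_cast h2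
  have h3' : (7 : ℝ) * coeff3 w ≤ -z := by exact_mod_cast h3
  -- `5 / 6` is the ratio of `p` and `1 - p` at `p = 5 / 11`, so that `u` vanishes there.
  obtain ⟨u, hu⟩ : ∃ u, u = p - 5 / 6 * (1 - p) := ⟨_, rfl⟩
  have hu0 : 0 ≤ u := by rw [hu]; linarith
  have hq0 : 0 ≤ 1 - p := by linarith
  have e0 := mul_le_mul_of_nonneg_right h0' (pow_nonneg hq0 3)
  have e1 := mul_le_mul_of_nonneg_right h1' (mul_nonneg (pow_nonneg hq0 2) hu0)
  have e2 := mul_le_mul_of_nonneg_right h2' (mul_nonneg hq0 (pow_nonneg hu0 2))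
  have e3 := mul_le_mul_of_nonneg_right h3' (pow_nonneg hu0 3)
  -- The expansion of `z * ((1 - p) + p) ^ 3` in powers of `1 - p` and `u`.
  have hone : (z : ℝ) = 1331 / 216 * z * (1 - p) ^ 3 + 363 / 36 * z * ((1 - p) ^ 2 * u)
      + 11 / 2 * z * ((1 - p) * u ^ 2) + z * u ^ 3 := by
    rw [hu]; ring
  have hexp : coeff0 w * (1 - p) ^ 3 + coeff1 w * (p * (1 - p) ^ 2) + coeff2 w * (p ^ 2 * (1 - p))
        + coeff3 w * p ^ 3
      = 1 / 216 * ((216 * coeff0 w + 180 * coeff1 w + 150 * coeff2 w + 125 * coeff3 w)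
          * (1 - p) ^ 3)
        + 1 / 36 * ((36 * coeff1 w + 60 * coeff2 w + 75 * coeff3 w) * ((1 - p) ^ 2 * u))
        + 1 / 2 * ((2 * coeff2 w + 5 * coeff3 w) * ((1 - p) * u ^ 2)) + coeff3 w * u ^ 3 := by
    rw [hu]; ring
  linarith

theorem wordEnergy_bounds_ofBits : ∀ a b c d e g : Bool,
    (if a then 0 else 1) ≤ wordEnergy (ofBits a b c d e g) ∧
      wordEnergy (ofBits a b c d e g) ≤ 400 := by
  decide +kernel

theorem wordEnergy_ofBits (w : ℕ → Bool) :
    wordEnergy (ofBits (w 0) (w 1) (w 2) (w 3) (w 4) (w 5)) = wordEnergy w := by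
  simp [wordEnergy, defect, ofBits]

theorem le_wordEnergy (w : ℕ → Bool) : (if w 0 then 0 else 1) ≤ wordEnergy w := by
  rw [← wordEnergy_ofBits]
  exact (wordEnergy_bounds_ofBits _ _ _ _ _ _).1

theorem wordEnergy_le (w : ℕ → Bool) : wordEnergy w ≤ 400 := by
  rw [← wordEnergy_ofBits]
  exact (wordEnergy_bounds_ofBits _ _ _ _ _ _).2

/-! ### Words on the cycle and the drift of the total energy -/

variable {n : ℕ} [NeZero n]

theorem ofNat_add (a b : ℕ) : Fin.ofNat n (a + b) = Fin.ofNat n a + Fin.ofNat n b := by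
  ext; simp [Fin.val_add]

theorem ofNat_inj_of_lt {a b : ℕ} (ha : a < n) (hb : b < n) :
    Fin.ofNat n a = Fin.ofNat n b ↔ a = b := by
  simp [Fin.ext_iff, Nat.mod_eq_of_lt ha, Nat.mod_eq_of_lt hb]

theorem ofNat_one : Fin.ofNat n 1 = 1 := rfl

/-- The word read off `x` to the right, starting at `j`. -/
def readFrom (x : Config n) (j : Fin n) : ℕ → Bool := fun k => x (j + Fin.ofNat n k)

theorem readFrom_zero (x : Config n) (j : Fin n) : readFrom x j 0 = x j := by
  simp [readFrom]

theorem readFrom_add (x : Config n) (j : Fin n) (s : ℕ) :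
    readFrom x (j + Fin.ofNat n s) = fun k => readFrom x j (k + s) := by
  funext k
  rw [readFrom, readFrom, add_comm k s, ofNat_add, add_assoc]

/-- The total energy of a configuration on the cycle. -/
def energy (x : Config n) : ℤ := ∑ j, wordEnergy (readFrom x j)

/-- The configuration `x` with the values at `i - 1`, `i`, `i + 1` replaced by `a`, `b`, `c`. -/
def setBlock (x : Config n) (i : Fin n) (a b c : Bool) : Config n := fun j =>
  if j + 1 = i then a else if j = i then b else if j = i + 1 then c else x j

theorem readFrom_setBlock (x : Config n) (j : Fin n) {o k : ℕ} (a b c : Bool)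
    (ho : o + 1 < n) (hk : k + 1 < n) :
    readFrom (setBlock x (j + Fin.ofNat n o) a b c) j k = setWord (readFrom x j) o a b c k := by
  simp only [readFrom, setBlock, setWord]
  rw [← ofNat_one, add_assoc, add_assoc, ← ofNat_add, ← ofNat_add]
  simp only [add_right_inj]
  simp only [ofNat_inj_of_lt hk (show o < n by lia), ofNat_inj_of_lt (show k < n by lia)
    (show o < n by lia), ofNat_inj_of_lt (show k < n by lia) ho]

theorem wordEnergy_congr {v w : ℕ → Bool} (h : ∀ k < 5, v k = w k) :
    wordEnergy v = wordEnergy w := by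
  simp [wordEnergy, defect, h]

theorem energyChange_at (hn : 8 ≤ n) (x : Config n) (j : Fin n) (a b c : Bool) {o s : ℕ}
    (ho : o ≤ 5) (hs : s ≤ 1) (hx : x (j + Fin.ofNat n o) = false) :
    wordEnergy (readFrom (setBlock x (j + Fin.ofNat n o) a b c) (j + Fin.ofNat n s))
        - wordEnergy (readFrom x (j + Fin.ofNat n s))
      = wordChange o s a b c (readFrom x j) := by
  have : readFrom x j o = false := hx
  rw [wordChange, this, cond_false, readFrom_add x]
  congr 1
  refine wordEnergy_congr fun k hk => ?_
  rw [readFrom_add]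
  exact readFrom_setBlock x j a b c (by lia) (by lia)

/-- An update at `i` does not change the words that do not meet the block around `i`. In the
hypothesis, the sites of the block are `i + l - 1` with `l < 3`. -/
theorem energyChange_far (x : Config n) (i j : Fin n) (a b c : Bool)
    (h : ∀ k < 5, ∀ l < 3, j + Fin.ofNat n k + 1 ≠ i + Fin.ofNat n l) :
    wordEnergy (readFrom (setBlock x i a b c) j) = wordEnergy (readFrom x j) := by
  refine wordEnergy_congr fun k hk => ?_
  have h0 := h k hk 0 (by lia)
  have h1 := h k hk 1 (by lia)
  have h2 := h k hk 2 (by lia)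
  rw [show Fin.ofNat n 0 = 0 from rfl, add_zero] at h0
  rw [ofNat_one] at h1
  rw [show Fin.ofNat n 2 = 1 + 1 by rw [← ofNat_one, ← ofNat_add], ← add_assoc] at h2
  simp only [readFrom, setBlock, h0, if_false]
  rw [if_neg fun e => h1 (by rw [e]), if_neg fun e => h2 (by rw [e])]

/-- Only the seven words that meet the block around `i` contribute to the change of the energy. -/
theorem energy_setBlock_sub (hn : 8 ≤ n) (x : Config n) (i : Fin n) (a b c : Bool) :
    energy (setBlock x i a b c) - energy x
      = ∑ t ∈ Finset.range 7, (wordEnergy (readFrom (setBlock x i a b c) (i + 1 - Fin.ofNat n t))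
          - wordEnergy (readFrom x (i + 1 - Fin.ofNat n t))) := by
  have hinj : Set.InjOn (fun t => i + 1 - Fin.ofNat n t) (Finset.range 7) := by
    intro s hs t ht hst
    simp only [Finset.coe_range, Set.mem_Iio] at hs ht
    exact (ofNat_inj_of_lt (by lia) (by lia)).1 (sub_right_injective hst)
  rw [← Finset.sum_image (s := Finset.range 7) (g := fun t => i + 1 - Fin.ofNat n t)
    (f := fun j => wordEnergy (readFrom (setBlock x i a b c) j) - wordEnergy (readFrom x j)) hinj,
    energy, energy, ← Finset.sum_sub_distrib]
  symm
  refine Finset.sum_subset (Finset.subset_univ _) fun j _ hj => ?_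
  -- A word whose site `k` is the block's site `l` starts at `i + 1 - (k + 2 - l)`.
  rw [sub_eq_zero]
  refine energyChange_far x i j a b c fun k hk l hl he => hj ?_
  refine Finset.mem_image.2 ⟨k + 2 - l, by simp; lia, ?_⟩
  have h1 : Fin.ofNat n (k + 2 - l) + Fin.ofNat n l = Fin.ofNat n k + 1 + 1 := by
    rw [← ofNat_one, ← ofNat_add, ← ofNat_add, ← ofNat_add]
    congr 1
    lia
  rw [sub_eq_iff_eq_add]
  apply add_right_cancel (b := Fin.ofNat n l)
  rw [add_assoc j, h1, add_right_comm i, ← he]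
  abel

theorem sum_add_ofNat {M : Type*} [AddCommMonoid M] (g : Fin n → M) (s : ℕ) :
    ∑ j, g (j + Fin.ofNat n s) = ∑ j, g j :=
  Equiv.sum_comp (Equiv.addRight (Fin.ofNat n s)) g

/-- The changes of the energy under updates at all zeros, added up, are the local changes within all
windows of six sites, added up. -/
theorem sum_energyChange (hn : 8 ≤ n) (x : Config n) (a b c : Bool) :
    ∑ i, (if x i then 0 else energy (setBlock x i a b c) - energy x)
      = ∑ j, localChange a b c (readFrom x j) := by
  have hmain : ∀ o s : ℕ, o ≤ 5 → s ≤ 1 →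
      ∑ i, (if x i then 0 else
        (wordEnergy (readFrom (setBlock x i a b c) (i - Fin.ofNat n o + Fin.ofNat n s))
          - wordEnergy (readFrom x (i - Fin.ofNat n o + Fin.ofNat n s))))
        = ∑ j, wordChange o s a b c (readFrom x j) := by
    intro o s ho hs
    -- Parametrize the picked vertices by the start `j` of the window, so that `i = j + o`.
    rw [← sum_add_ofNat _ o]
    refine Finset.sum_congr rfl fun j _ => ?_
    rw [add_sub_cancel_right]
    rcases hx : x (j + Fin.ofNat n o) with _ | _
    · simpa using energyChange_at hn x j a b c ho hs hx
    · have : readFrom x j o = true := hx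
      simp [wordChange, this]
  simp only [localChange, Finset.sum_add_distrib]
  rw [← hmain 0 1 (by lia) (by lia), ← hmain 0 0 (by lia) (by lia), ← hmain 1 0 (by lia) (by lia),
    ← hmain 2 0 (by lia) (by lia), ← hmain 3 0 (by lia) (by lia), ← hmain 4 0 (by lia) (by lia),
    ← hmain 5 0 (by lia) (by lia)]
  simp only [← Finset.sum_add_distrib]
  refine Finset.sum_congr rfl fun i _ => ?_
  split_ifs
  · simp
  · have hz : Fin.ofNat n 0 = 0 := rfl
    have hs : ∀ t : ℕ, i + 1 - Fin.ofNat n (t + 1) = i - Fin.ofNat n t := fun t => by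
      rw [ofNat_add, ofNat_one]; abel
    rw [energy_setBlock_sub hn, Finset.sum_range_succ', add_comm]
    simp only [hs, Finset.sum_range_succ, Finset.sum_range_zero, hz, sub_zero, add_zero, ofNat_one,
      zero_add]

/-- The vertices with value zero. -/
def zeros {m : ℕ} (x : Config m) : Finset (Fin m) := Finset.univ.filter fun i => x i = false

/-- On average over the zeros of `x`, an update at a zero lowers the energy by at least `1 / 7`. -/
theorem sum_expected_energyChange_le (hn : 8 ≤ n) {p : ℝ} (hp : 5 / 11 ≤ p) (hp1 : p ≤ 1)
    (x : Config n) :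
    ∑ i ∈ zeros x, ∑ a, ∑ b, ∑ c,
        outcomeWeight p a b c * ((energy (setBlock x i a b c) : ℝ) - energy x)
      ≤ -(1 / 7) * (zeros x).card := by
  have hsum : ∀ a b c : Bool,
      ∑ i ∈ zeros x, ((energy (setBlock x i a b c) : ℝ) - energy x)
        = ∑ j, (localChange a b c (readFrom x j) : ℝ) := by
    intro a b c
    have h := sum_energyChange hn x a b c
    rw [zeros, Finset.sum_filter, ← Int.cast_sum, ← h, Int.cast_sum]
    refine Finset.sum_congr rfl fun i _ => ?_
    rcases hx : x i with _ | _ <;> simp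
  have hcard : ((zeros x).card : ℝ) = ∑ j, (if readFrom x j 0 then 0 else 1 : ℝ) := by
    rw [zeros, Finset.card_filter]
    push_cast
    refine Finset.sum_congr rfl fun i _ => ?_
    rw [readFrom_zero]
    rcases hx : x i with _ | _ <;> simp
  have htel : ∑ j, (potential p (fun k => readFrom x j (k + 1)) - potential p (readFrom x j))
      = 0 := by
    rw [Finset.sum_sub_distrib, sub_eq_zero,
      ← sum_add_ofNat (fun j => potential p (readFrom x j)) 1]
    simp only [readFrom_add]
  calc _ = ∑ j, ∑ a, ∑ b, ∑ c, outcomeWeight p a b c * (localChange a b c (readFrom x j) : ℝ) := by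
        rw [Finset.sum_comm]
        rw [Finset.sum_comm (s := Finset.univ (α := Fin n))]
        refine Finset.sum_congr rfl fun a _ => ?_
        rw [Finset.sum_comm]
        rw [Finset.sum_comm (s := Finset.univ (α := Fin n))]
        refine Finset.sum_congr rfl fun b _ => ?_
        rw [Finset.sum_comm]
        rw [Finset.sum_comm (s := Finset.univ (α := Fin n))]
        refine Finset.sum_congr rfl fun c _ => ?_
        rw [← Finset.mul_sum, ← Finset.mul_sum, hsum]
    _ ≤ ∑ j, (potential p (fun k => readFrom x j (k + 1)) - potential p (readFrom x j)
          - 1 / 7 * (if readFrom x j 0 then 0 else 1)) :=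
        Finset.sum_le_sum fun j _ => sum_outcomeWeight_localChange_le hp hp1 _
    _ = -(1 / 7) * (zeros x).card := by
        rw [Finset.sum_sub_distrib, htel, ← Finset.mul_sum, ← hcard]
        ring

/-! ### One step of the chain in terms of updated configurations -/

theorem add_one_ne (hn : 3 ≤ n) (i : Fin n) : i + 1 ≠ i := by
  intro h
  have h1 : Fin.ofNat n 1 = Fin.ofNat n 0 := add_left_cancel (h.trans (add_zero i).symm)
  exact absurd ((ofNat_inj_of_lt (by lia) (by lia)).1 h1) one_ne_zero

theorem add_one_add_one_ne (hn : 3 ≤ n) (i : Fin n) : i + 1 + 1 ≠ i := by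
  intro h
  rw [add_assoc] at h
  have h1 : Fin.ofNat n (1 + 1) = Fin.ofNat n 0 := by
    rw [ofNat_add]
    exact add_left_cancel (h.trans (add_zero i).symm)
  exact absurd ((ofNat_inj_of_lt (by lia) (by lia)).1 h1) two_ne_zero

theorem setBlock_sub_one (x : Config n) (i : Fin n) (a b c : Bool) :
    setBlock x i a b c (i - 1) = a := by
  simp [setBlock]

theorem setBlock_self (hn : 3 ≤ n) (x : Config n) (i : Fin n) (a b c : Bool) :
    setBlock x i a b c i = b := by
  simp only [setBlock, add_one_ne hn, if_false, if_true]

theorem setBlock_add_one (hn : 3 ≤ n) (x : Config n) (i : Fin n) (a b c : Bool) :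
    setBlock x i a b c (i + 1) = c := by
  simp only [setBlock, add_one_ne hn, add_one_add_one_ne hn, if_false, if_true]

theorem setBlock_of_notMem (x : Config n) {i j : Fin n} (a b c : Bool) (hj : j ∉ block i) :
    setBlock x i a b c j = x j := by
  simp only [block, Finset.mem_insert, Finset.mem_singleton, not_or, eq_sub_iff_add_eq] at hj
  simp only [setBlock, hj, if_false]

theorem updateProb_setBlock (hn : 3 ≤ n) (p : ℝ) (x : Config n) (i : Fin n) (a b c : Bool) :
    updateProb p x i (setBlock x i a b c) = outcomeWeight p a b c := by
  have h : updateProb p x i (setBlock x i a b c)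
      = ∏ j, if j ∈ block i then bernoulliWeight p (setBlock x i a b c j) else 1 := by
    refine Finset.prod_congr rfl fun j _ => ?_
    split_ifs with h1 h2
    · rfl
    · rfl
    · exact absurd (setBlock_of_notMem x a b c h1) h2
  have h1 : i - 1 ∉ ({i, i + 1} : Finset (Fin n)) := by
    simp only [Finset.mem_insert, Finset.mem_singleton, sub_eq_iff_eq_add, not_or]
    exact ⟨(add_one_ne hn i).symm, (add_one_add_one_ne hn i).symm⟩
  have h2 : i ∉ ({i + 1} : Finset (Fin n)) := by
    simpa only [Finset.mem_singleton] using (add_one_ne hn i).symm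
  rw [h, Finset.prod_ite_mem, Finset.univ_inter, block, Finset.prod_insert h1,
    Finset.prod_insert h2, Finset.prod_singleton, setBlock_sub_one, setBlock_self hn,
    setBlock_add_one hn, outcomeWeight, mul_assoc]

theorem sum_updateProb_mul (hn : 3 ≤ n) (p : ℝ) (x : Config n) (i : Fin n) (g : Config n → ℝ) :
    ∑ y, updateProb p x i y * g y
      = ∑ a, ∑ b, ∑ c, outcomeWeight p a b c * g (setBlock x i a b c) := by
  symm
  simp only [← Fintype.sum_prod_type']
  refine Fintype.sum_of_injective (fun t : Bool × Bool × Bool => setBlock x i t.1 t.2.1 t.2.2)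
    ?_ _ _ ?_ ?_
  · rintro ⟨a, b, c⟩ ⟨a', b', c'⟩ h
    have h1 := congrFun h (i - 1)
    have h2 := congrFun h i
    have h3 := congrFun h (i + 1)
    simp only [setBlock_sub_one, setBlock_self hn, setBlock_add_one hn] at h1 h2 h3
    rw [h1, h2, h3]
  · intro y hy
    have : ∃ j, j ∉ block i ∧ y j ≠ x j := by
      by_contra! hcon
      refine hy ⟨(y (i - 1), y i, y (i + 1)), funext fun j => ?_⟩
      by_cases hj : j ∈ block i
      · simp only [block, Finset.mem_insert, Finset.mem_singleton] at hj
        rcases hj with rfl | rfl | rfl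
        · exact setBlock_sub_one ..
        · exact setBlock_self hn ..
        · exact setBlock_add_one hn ..
      · exact (setBlock_of_notMem x _ _ _ hj).trans (hcon j hj).symm
    obtain ⟨j, hj, hyj⟩ := this
    rw [updateProb, Finset.prod_eq_zero (Finset.mem_univ j) (by simp [hj, hyj]), zero_mul]
  · rintro ⟨a, b, c⟩
    simp only [updateProb_setBlock hn]

theorem sum_transition_mul (hn : 3 ≤ n) (p : ℝ) (x : Config n) (g : Config n → ℝ) :
    ∑ y, transition n p x y * g y
      = 1 / ((eligible x).card : ℝ) * ∑ i ∈ eligible x, ∑ a, ∑ b, ∑ c,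
          outcomeWeight p a b c * g (setBlock x i a b c) := by
  simp only [transition, Finset.sum_mul, mul_assoc, ← sum_updateProb_mul hn, Finset.mul_sum]
  exact Finset.sum_comm

theorem eligible_eq_zeros {m : ℕ} {x : Config m} (hx : (zeros x).Nonempty) :
    eligible x = zeros x := by
  obtain ⟨i, hi⟩ := hx
  exact if_pos ⟨i, (Finset.mem_filter.1 hi).2⟩

/-! ### Stationary bounds -/

theorem card_zeros_le_energy (x : Config n) : ((zeros x).card : ℤ) ≤ energy x := by
  rw [zeros, Finset.card_filter, energy, Nat.cast_sum]
  refine Finset.sum_le_sum fun j _ => le_trans (le_of_eq ?_) (le_wordEnergy (readFrom x j))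
  rw [readFrom_zero]
  rcases x j with _ | _ <;> simp

theorem energy_nonneg (x : Config n) : 0 ≤ energy x :=
  (Int.natCast_nonneg _).trans (card_zeros_le_energy x)

theorem energy_eq_zero {x : Config n} (hx : ¬ (zeros x).Nonempty) : energy x = 0 := by
  have h : ∀ j, x j = true := fun j => by
    by_contra hj
    exact hx ⟨j, Finset.mem_filter.2 ⟨Finset.mem_univ j, by simpa using hj⟩⟩
  exact Finset.sum_eq_zero fun j _ => by simp [wordEnergy, defect, readFrom, h]

/-- Seven words change, each by at most `400`. -/
theorem abs_energy_setBlock_sub_le (hn : 8 ≤ n) (x : Config n) (i : Fin n) (a b c : Bool) :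
    |energy (setBlock x i a b c) - energy x| ≤ 2800 := by
  rw [energy_setBlock_sub hn]
  refine (Finset.abs_sum_le_sum_abs _ _).trans ?_
  refine (Finset.sum_le_card_nsmul _ _ 400 fun t _ => ?_).trans (by simp)
  have hw : ∀ w, 0 ≤ wordEnergy w := fun w => le_trans (by split_ifs <;> simp) (le_wordEnergy w)
  rw [abs_le]
  constructor <;>
  linarith [hw (readFrom (setBlock x i a b c) (i + 1 - Fin.ofNat n t)),
    hw (readFrom x (i + 1 - Fin.ofNat n t)), wordEnergy_le (readFrom x (i + 1 - Fin.ofNat n t)),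
    wordEnergy_le (readFrom (setBlock x i a b c) (i + 1 - Fin.ofNat n t))]

theorem sum_transition_mul_energy_sub_le (hn : 8 ≤ n) {p : ℝ} (hp : 5 / 11 ≤ p) (hp1 : p ≤ 1)
    {x : Config n} (hx : (zeros x).Nonempty) :
    ∑ y, transition n p x y * ((energy y : ℝ) - energy x) ≤ -(1 / 7) := by
  have hc : (0 : ℝ) < (zeros x).card := by exact_mod_cast Finset.card_pos.2 hx
  rw [sum_transition_mul (by lia), eligible_eq_zeros hx, one_div_mul_eq_div, div_le_iff₀ hc]
  exact sum_expected_energyChange_le hn hp hp1 x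

theorem sum_transition_mul_energy_sub_sq_le (hn : 8 ≤ n) {p : ℝ} (hp : p ∈ Set.Icc (0 : ℝ) 1)
    (x : Config n) :
    ∑ y, transition n p x y * ((energy y : ℝ) - energy x) ^ 2 ≤ 2800 ^ 2 := by
  have hrow := Matrix.sum_row_of_mem_rowStochastic (transition_mem_rowStochastic (n := n) hp) x
  calc ∑ y, transition n p x y * ((energy y : ℝ) - energy x) ^ 2
      ≤ ∑ y, transition n p x y * 2800 ^ 2 := by
        rw [sum_transition_mul (by lia), sum_transition_mul (by lia) p x fun _ => 2800 ^ 2]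
        refine mul_le_mul_of_nonneg_left (Finset.sum_le_sum fun i _ => ?_) (by positivity)
        refine Finset.sum_le_sum fun a _ => Finset.sum_le_sum fun b _ =>
          Finset.sum_le_sum fun c _ => ?_
        refine mul_le_mul_of_nonneg_left ?_ (mul_nonneg (mul_nonneg (bernoulliWeight_nonneg hp a)
          (bernoulliWeight_nonneg hp b)) (bernoulliWeight_nonneg hp c))
        rw [← sq_abs]
        have := abs_energy_setBlock_sub_le hn x i a b c
        gcongr
        exact_mod_cast this
    _ = 2800 ^ 2 := by rw [← Finset.sum_mul, hrow, one_mul]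

/-- The stationary mean of the energy is bounded uniformly in `n`: the stationary mean change of the
square of the energy is zero, while from `x` it is at most `2800 ^ 2 - (2 / 7) * energy x`. -/
theorem sum_stationary_mul_energy_le (hn : 8 ≤ n) (p : unitInterval) (hp : 5 / 11 ≤ (p : ℝ)) :
    ∑ x, stationary n p x * energy x ≤ 7 / 2 * 2800 ^ 2 := by
  obtain ⟨⟨hπ0, hπ1⟩, hst⟩ := stationary_spec n p
  set π := stationary n p
  have hrow := fun x =>
    Matrix.sum_row_of_mem_rowStochastic (transition_mem_rowStochastic (n := n) p.2) x
  have hinv : ∑ x, π x * ∑ y, transition n p x y * ((energy y : ℝ) ^ 2 - (energy x : ℝ) ^ 2)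
      = 0 := by
    have h1 : ∑ x, π x * ∑ y, transition n p x y * (energy y : ℝ) ^ 2
        = ∑ y, π y * (energy y : ℝ) ^ 2 := by
      simp only [Finset.mul_sum]
      rw [Finset.sum_comm]
      refine Finset.sum_congr rfl fun y _ => ?_
      simp only [← mul_assoc, ← Finset.sum_mul]
      congr 1
      exact congrFun hst y
    simp only [mul_sub, Finset.sum_sub_distrib, h1, ← Finset.sum_mul, hrow, one_mul, sub_self]
  have hle : ∀ x, ∑ y, transition n p x y * ((energy y : ℝ) ^ 2 - (energy x : ℝ) ^ 2)
      ≤ 2800 ^ 2 - 2 / 7 * energy x := by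
    intro x
    have hsplit : ∑ y, transition n p x y * ((energy y : ℝ) ^ 2 - (energy x : ℝ) ^ 2)
        = 2 * energy x * ∑ y, transition n p x y * ((energy y : ℝ) - energy x)
          + ∑ y, transition n p x y * ((energy y : ℝ) - energy x) ^ 2 := by
      rw [Finset.mul_sum, ← Finset.sum_add_distrib]
      exact Finset.sum_congr rfl fun y _ => by ring
    have hsq := sum_transition_mul_energy_sub_sq_le hn p.2 x
    have hlin : 2 * (energy x : ℝ) * ∑ y, transition n p x y * ((energy y : ℝ) - energy x)
        ≤ -(2 / 7) * energy x := by
      by_cases hx : (zeros x).Nonempty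
      · have h0 : (0 : ℝ) ≤ energy x := by exact_mod_cast energy_nonneg x
        nlinarith [sum_transition_mul_energy_sub_le hn hp p.2.2 hx]
      · simp [energy_eq_zero hx]
    rw [hsplit]
    linarith
  have hfin : (0 : ℝ) ≤ ∑ x, π x * (2800 ^ 2 - 2 / 7 * energy x) := by
    rw [← hinv]
    exact Finset.sum_le_sum fun x _ => mul_le_mul_of_nonneg_left (hle x) (hπ0 x)
  have hexp : ∑ x, π x * (2800 ^ 2 - 2 / 7 * (energy x : ℝ))
      = 2800 ^ 2 - 2 / 7 * ∑ x, π x * energy x := by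
    simp only [mul_sub, Finset.sum_sub_distrib, ← Finset.sum_mul, hπ1, one_mul, Finset.mul_sum]
    congr 1
    exact Finset.sum_congr rfl fun x _ => by ring
  linarith

/-- By rotational symmetry, the stationary mean number of zeros is `n * (1 - nu n p)`. -/
theorem card_mul_one_sub_nu (p : unitInterval) :
    n * (1 - nu n p) = ∑ x, stationary n p x * (zeros x).card := by
  obtain ⟨⟨_, hπ1⟩, -⟩ := stationary_spec n p
  have h : ∀ i : Fin n, 1 - nu n p = ∑ x, stationary n p x * (if x i = false then 1 else 0) := by
    intro i
    rw [sub_eq_iff_eq_add, ← nuAt_eq_nu p i, nuAt, ← Finset.sum_add_distrib]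
    refine hπ1.symm.trans (Finset.sum_congr rfl fun x _ => ?_)
    rcases x i with _ | _ <;> simp
  calc n * (1 - nu n p) = ∑ _i : Fin n, (1 - nu n p) := by
        rw [Finset.sum_const, Finset.card_univ, Fintype.card_fin, nsmul_eq_mul]
    _ = ∑ i : Fin n, ∑ x, stationary n p x * (if x i = false then 1 else 0) :=
        Finset.sum_congr rfl fun i _ => h i
    _ = ∑ x, stationary n p x * (zeros x).card := by
        rw [Finset.sum_comm]
        refine Finset.sum_congr rfl fun x _ => ?_
        rw [← Finset.mul_sum, zeros, Finset.card_filter]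
        push_cast
        rfl

theorem nu_le_one (p : unitInterval) : nu n p ≤ 1 := by
  have h := card_mul_one_sub_nu (n := n) p
  have hn : (0 : ℝ) < n := by exact_mod_cast Nat.pos_of_neZero n
  have h0 : 0 ≤ ∑ x, stationary n p x * ((zeros x).card : ℝ) :=
    Finset.sum_nonneg fun x _ => mul_nonneg ((stationary_spec n p).1.1 x) (Nat.cast_nonneg _)
  rw [← h] at h0
  linarith [nonneg_of_mul_nonneg_right h0 hn]

theorem one_sub_le_nu (hn : 8 ≤ n) (p : unitInterval) (hp : 5 / 11 ≤ (p : ℝ)) :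
    1 - 7 / 2 * 2800 ^ 2 / n ≤ nu n p := by
  have hn0 : (0 : ℝ) < n := by exact_mod_cast (by lia : 0 < n)
  have h1 : ∑ x, stationary n p x * ((zeros x).card : ℝ) ≤ ∑ x, stationary n p x * energy x :=
    Finset.sum_le_sum fun x _ => mul_le_mul_of_nonneg_left
      (by exact_mod_cast card_zeros_le_energy x) ((stationary_spec n p).1.1 x)
  have h2 := sum_stationary_mul_energy_le hn p hp
  rw [← card_mul_one_sub_nu] at h1
  rw [sub_le_comm, le_div_iff₀ hn0]
  linarith

theorem hasLimit_one {p : unitInterval} (hp : 5 / 11 ≤ (p : ℝ)) : HasLimit p 1 := by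
  have hlow : Tendsto (fun m : ℕ => 1 - 7 / 2 * 2800 ^ 2 / (((m + 3 : ℕ) : ℝ))) atTop (𝓝 1) := by
    have := (tendsto_const_div_atTop_nhds_zero_nat (7 / 2 * 2800 ^ 2 : ℝ)).comp
      (tendsto_add_atTop_nat 3)
    simpa using this.const_sub 1
  refine tendsto_of_tendsto_of_tendsto_of_le_of_le' hlow tendsto_const_nhds ?_
    (Eventually.of_forall fun m => nu_le_one p)
  filter_upwards [eventually_ge_atTop 5] with m hm
  exact one_sub_le_nu (by lia) p hp

theorem IsCritical.le_of_hasLimit {pc q : ℝ} (hpc : IsCritical pc) (hq0 : 0 ≤ q)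
    (h : ∀ p : unitInterval, q < (p : ℝ) → HasLimit p 1) : pc ≤ q := by
  by_contra! hlt
  obtain ⟨p, hqp, hppc⟩ := exists_between hlt
  obtain ⟨a, ha, hlim⟩ := hpc.2.2 ⟨p, (hq0.trans hqp.le), hppc.le.trans hpc.1.2⟩ hppc
  exact ha.ne (tendsto_nhds_unique hlim (h _ hqp))

end BakSneppen

theorem theorem1 :
    ∃ q : ℝ, (0.45 ≤ q ∧ q < 0.46) ∧
      (∀ r : ℝ, (0 ≤ r ∧ r ^ 5 + 4 * r ^ 4 + 2 * r ^ 3 + 3 * r ^ 2 = 1) ↔ r = q) ∧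
      (∀ p : unitInterval, q < (p : ℝ) → BakSneppen.HasLimit p 1) ∧
      (∀ pc : ℝ, BakSneppen.IsCritical pc → pc ≤ q) := by
  set φ : ℝ → ℝ := fun r => r ^ 5 + 4 * r ^ 4 + 2 * r ^ 3 + 3 * r ^ 2 with hφ
  have hmono : StrictMonoOn φ (Set.Ici 0) := by
    intro r hr s _ hrs
    have hr : 0 ≤ r := hr
    simp only [hφ]
    gcongr
  have hcont : Continuous φ := by fun_prop
  obtain ⟨q, ⟨hq1, hq2⟩, hq⟩ : (1 : ℝ) ∈ φ '' Set.Ioo (5 / 11) 0.46 :=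
    intermediate_value_Ioo (by norm_num) hcont.continuousOn ⟨by norm_num [hφ], by norm_num [hφ]⟩
  have hq0 : 0 ≤ q := by linarith
  have hlim : ∀ p : unitInterval, q < (p : ℝ) → BakSneppen.HasLimit p 1 :=
    fun p hp => BakSneppen.hasLimit_one (by linarith)
  refine ⟨q, ⟨by norm_num; linarith, hq2⟩, fun r => ⟨fun ⟨hr0, hr⟩ => ?_, ?_⟩, hlim,
    fun pc hpc => hpc.le_of_hasLimit hq0 hlim⟩
  · exact hmono.injOn hr0 hq0 (hr.trans hq.symm)
  · rintro rfl
    exact ⟨hq0, hq⟩
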